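/- Let $n\ge 0$, $G=\mathrm{GL}(n,\mathbb C)$ regarded as a real Lie group, $\mathfrak g_0=\mathfrak{gl}(n,\mathbb C)$ its real Lie algebra, $\mathfrak g=\mathfrak g_0\otimes_{\mathbb R}\mathbb C$, $K=\mathrm U(n)$, and $B\subset G$ the subgroup of upper triangular matrices, with diagonal entries of $b\in B$ denoted $b_1,\dots,b_n$. For a finite-dimensional complex representation $(\tau,W)$ of $B$ let $\operatorname{Ind}_B^G(\tau)$ be the $(\mathfrak g,K)$-module of all smooth, right $K$-finite functions $f:G\to W$ with $$f(bg)=\delta(b)^{1/2}\,\tau(b)f(g)\quad(b\in B,\ g\in G),\qquad \delta(b)=\prod_{i=1}^n|b_i|^{2(n+1-2i)},$$ with $K$ acting by right translation and $\mathfrak g$ by its derivative; if $W'\subseteq W$ is $B$-stable, $\operatorname{Ind}_B^G(W')$ is the subspace of $W'$-valued functions. Let $\lambda=(\lambda_L,\lambda_R)$ with $\lambda_L,\lambda_R\in\mathbb C^n$ and $\lambda_L-\lambda_R\in\mathbb Z^n$, let $\mathbb C_\lambda$ be the one-dimensional representation $$b\mapsto \prod_{i=1}^n b_i^{\lambda_{L,i}}\,\overline{b_i}^{\,\lambda_{R,i}}=\prod_{i=1}^n|b_i|^{\lambda_{L,i}+\lambda_{R,i}}\Big(\frac{b_i}{|b_i|}\Big)^{\lambda_{L,i}-\lambda_{R,i}}$$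 of $B$, and let $X(\lambda)=\operatorname{Ind}_B^G(\mathbb C_\lambda)$ be the principal series $(\mathfrak g,K)$-module. Let $V=\mathbb C^n$ be the conjugate standard representation of $G$, in which $g$ acts by $v\mapsto\bar g v$, let $e_1,\dots,e_n$ be its standard basis, and let $V_k=\operatorname{span}\{e_1,\dots,e_k\}$ for $0\le k\le n$; each $V_k$ is $B$-stable. In $\lambda_R+e_k$ the symbol $e_k$ denotes the $k$-th unit vector of $\mathbb C^n$. Then the Mackey map $f\otimes v\mapsto[g\mapsto f(g)\,\bar g v]$ is an isomorphism of $(\mathfrak g,K)$-modules $$M:\ X(\lambda)\otimes V\ \xrightarrow{\ \sim\ }\ \operatorname{Ind}_B^G(\mathbb C_\lambda\otimes V),$$ and the subspaces $X_k=M^{-1}\big(\operatorname{Ind}_B^G(\mathbb C_\lambda\otimes V_k)\big)$, $0\le k\le n$, form a filtration by $(\mathfrak g,K)$-submodules $$0=X_0\subseteq X_1\subseteq\cdots\subseteq X_n=X(\lambda)\otimes V$$ such that, for every $k=1,\dots,n$, there is an isomorphism of $(\mathfrak g,K)$-modules $$X_k/X_{k-1}\;\cong\;X(\lambda_L,\lambda_R+e_k).$$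 -/

import Mathlib

open scoped Matrix TensorProduct ContDiff ComplexConjugate

noncomputable section

namespace GLComplex

lemma finiteDimensional_of_le {𝕜 X : Type*} [Field 𝕜] [AddCommGroup X] [Module 𝕜 X]
    {S T : Submodule 𝕜 X} (hT : FiniteDimensional 𝕜 T) (h : S ≤ T) : FiniteDimensional 𝕜 S :=
  Submodule.finiteDimensional_of_le h

/-- The unitary group `K = U(n)`, a maximal compact subgroup of `GL(n, ℂ)`. -/
abbrev UnitaryK (n : ℕ) : Type := Matrix.unitaryGroup (Fin n) ℂ

/-- The matrix space `𝔤₀ = 𝔤𝔩(n, ℂ)`, regarded as a real Lie algebra with the commutator bracket. -/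
abbrev Gl (n : ℕ) : Type := Matrix (Fin n) (Fin n) ℂ

/-- A `(𝔤, K)`-module for `GL(n, ℂ)` with underlying complex vector space `X`.
The complexified Lie algebra `𝔤 = 𝔤₀ ⊗_ℝ ℂ` acts complex linearly, which is the same as an action of
the real Lie algebra `𝔤₀` by complex linear operators. In `differential`, `c t = exp (t E)` is a
one-parameter subgroup of `K`; testing against linear functionals expresses the derivative in the
(finite dimensional) space where the orbit of `x` lives. -/
structure GKModule (n : ℕ) (X : Type*) [AddCommGroup X] [Module ℂ X] where
  kAct : Representation ℂ (UnitaryK n) X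
  gAct : Gl n → Module.End ℂ X
  gAct_add : ∀ E E', gAct (E + E') = gAct E + gAct E'
  gAct_smul : ∀ (r : ℝ) E, gAct (r • E) = (r : ℂ) • gAct E
  gAct_lie : ∀ E E', gAct (E * E' - E' * E) = gAct E * gAct E' - gAct E' * gAct E
  locallyFinite : ∀ x,
    FiniteDimensional ℂ (Submodule.span ℂ (Set.range fun k : UnitaryK n => kAct k x))
  adjoint : ∀ (k : UnitaryK n) E x,
    kAct k (gAct E x) = gAct ((k : Gl n) * E * star (k : Gl n)) (kAct k x)
  differential : ∀ (E : Gl n) (c : ℝ → UnitaryK n),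
    (∀ t : ℝ, (c t : Gl n) = NormedSpace.exp (t • E)) →
    ∀ (x : X) (φ : Module.Dual ℂ X),
      HasDerivAt (fun t : ℝ => φ (kAct (c t) x)) (φ (gAct E x)) 0

namespace GKModule

variable {n : ℕ} {X Y : Type*} [AddCommGroup X] [Module ℂ X] [AddCommGroup Y] [Module ℂ Y]

/-- A complex subspace stable under `K` and `𝔤`, that is, a `(𝔤, K)`-submodule. -/
def IsStable (A : GKModule n X) (P : Submodule ℂ X) : Prop :=
  (∀ k, ∀ x ∈ P, A.kAct k x ∈ P) ∧ ∀ E, ∀ x ∈ P, A.gAct E x ∈ P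

/-- The `(𝔤, K)`-module structure on a `(𝔤, K)`-submodule. -/
def sub (A : GKModule n X) {P : Submodule ℂ X} (h : A.IsStable P) : GKModule n P where
  kAct := A.kAct.subrepresentation P fun k x hx => h.1 k x hx
  gAct E := (A.gAct E).restrict (h.2 E)
  gAct_add E E' := by ext x; simp [A.gAct_add]
  gAct_smul r E := by ext x; simp [A.gAct_smul]
  gAct_lie E E' := by ext x; simp [A.gAct_lie]
  locallyFinite x := by
    have e := Submodule.equivMapOfInjective P.subtype P.injective_subtype
      (Submodule.span ℂ (Set.range fun k : UnitaryK n =>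
        A.kAct.subrepresentation P (fun k x hx => h.1 k x hx) k x))
    rw [Submodule.map_span, ← Set.range_comp] at e
    exact @LinearEquiv.finiteDimensional _ _ _ _ _ _ _ _ e.symm (A.locallyFinite x)
  adjoint k E x := by
    ext
    exact A.adjoint k E x
  differential E c hc x φ := by
    obtain ⟨ψ, hψ⟩ := LinearMap.exists_extend φ
    subst hψ
    exact A.differential E c hc x ψ

/-- The `(𝔤, K)`-module structure on the quotient by a `(𝔤, K)`-submodule. -/
def quot (A : GKModule n X) {P : Submodule ℂ X} (h : A.IsStable P) : GKModule n (X ⧸ P) where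
  kAct := A.kAct.quotient P fun k x hx => h.1 k x hx
  gAct E := P.mapQ P (A.gAct E) (h.2 E)
  gAct_add E E' := by ext x; simp [A.gAct_add]
  gAct_smul r E := by ext x; simp [A.gAct_smul]
  gAct_lie E E' := by ext x; simp [A.gAct_lie]
  locallyFinite x := by
    obtain ⟨x, rfl⟩ := P.mkQ_surjective x
    have := A.locallyFinite x
    have e : (Submodule.span ℂ (Set.range fun k : UnitaryK n => A.kAct k x)).map P.mkQ =
        Submodule.span ℂ (Set.range fun k : UnitaryK n =>
          A.kAct.quotient P (fun k x hx => h.1 k x hx) k (P.mkQ x)) := by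
      rw [Submodule.map_span, ← Set.range_comp]
      rfl
    rw [← e]
    infer_instance
  adjoint k E x := by
    obtain ⟨x, rfl⟩ := P.mkQ_surjective x
    exact congrArg P.mkQ (A.adjoint k E x)
  differential E c hc x φ := by
    obtain ⟨x, rfl⟩ := P.mkQ_surjective x
    exact A.differential E c hc x (φ ∘ₗ P.mkQ)

lemma IsStable.submoduleOf {A : GKModule n X} {P Q : Submodule ℂ X} (hP : A.IsStable P)
    (hQ : A.IsStable Q) : (A.sub hQ).IsStable (P.submoduleOf Q) :=
  ⟨fun k x hx => hP.1 k x hx, fun E x hx => hP.2 E x hx⟩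

/-- The subquotient `Q / P` of two `(𝔤, K)`-submodules (used for `P ≤ Q`). -/
def subquot (A : GKModule n X) {P Q : Submodule ℂ X} (hP : A.IsStable P) (hQ : A.IsStable Q) :
    GKModule n (Q ⧸ P.submoduleOf Q) :=
  (A.sub hQ).quot (hP.submoduleOf hQ)

/-- An isomorphism of `(𝔤, K)`-modules. -/
structure Iso (A : GKModule n X) (B : GKModule n Y) extends X ≃ₗ[ℂ] Y where
  map_kAct : ∀ k x, toLinearEquiv (A.kAct k x) = B.kAct k (toLinearEquiv x)
  map_gAct : ∀ E x, toLinearEquiv (A.gAct E x) = B.gAct E (toLinearEquiv x)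

lemma one_of_curve {E : Gl n} {c : ℝ → UnitaryK n}
    (hc : ∀ t : ℝ, (c t : Gl n) = NormedSpace.exp (t • E)) : c 0 = 1 := by
  apply Subtype.ext
  rw [hc]
  simp

/-- The tensor product of two `(𝔤, K)`-modules, with diagonal `K`-action and `𝔤` acting by the
Leibniz rule. -/
def tensor (A : GKModule n X) (B : GKModule n Y) : GKModule n (X ⊗[ℂ] Y) where
  kAct := A.kAct.tprod B.kAct
  gAct E := TensorProduct.map (A.gAct E) LinearMap.id + TensorProduct.map LinearMap.id (B.gAct E)
  gAct_add E E' := by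
    ext x y
    simp [A.gAct_add, B.gAct_add, TensorProduct.add_tmul, TensorProduct.tmul_add]
    abel
  gAct_smul r E := by
    ext x y
    simp [A.gAct_smul, B.gAct_smul, TensorProduct.smul_tmul', -Complex.coe_smul]
  gAct_lie E E' := by
    ext x y
    simp [A.gAct_lie, B.gAct_lie, TensorProduct.sub_tmul, TensorProduct.tmul_sub]
    abel
  locallyFinite z := by
    induction z with
    | zero =>
      simpa only [map_zero] using! Module.Finite.span_of_finite ℂ
        (Set.finite_range_const (c := (0 : X ⊗[ℂ] Y)) (α := UnitaryK n))
    | tmul x y =>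
      have h1 := Module.Finite.iff_fg.1 (A.locallyFinite x)
      have h2 := Module.Finite.iff_fg.1 (B.locallyFinite y)
      have h3 := Module.Finite.iff_fg.2 (h1.map₂ (TensorProduct.mk ℂ X Y) h2)
      refine finiteDimensional_of_le h3 ?_
      rw [Submodule.span_le]
      rintro _ ⟨k, rfl⟩
      exact Submodule.apply_mem_map₂ _ (Submodule.subset_span ⟨k, rfl⟩)
        (Submodule.subset_span ⟨k, rfl⟩)
    | add z w hz hw =>
      refine Submodule.finiteDimensional_of_le (S₂ :=
        Submodule.span ℂ (Set.range fun k : UnitaryK n => A.kAct.tprod B.kAct k z) ⊔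
        Submodule.span ℂ (Set.range fun k : UnitaryK n => A.kAct.tprod B.kAct k w)) ?_
      rw [Submodule.span_le]
      rintro _ ⟨k, rfl⟩
      simp only [map_add]
      exact Submodule.add_mem_sup (Submodule.subset_span ⟨k, rfl⟩) (Submodule.subset_span ⟨k, rfl⟩)
  adjoint k E z := by
    induction z with
    | zero => simp
    | tmul x y => simp [A.adjoint, B.adjoint]
    | add z w hz hw => simp only [map_add, hz, hw]
  differential E c hc z φ := by
    induction z with
    | zero => simpa using hasDerivAt_const (0 : ℝ) (0 : ℂ)
    | add z w hz hw =>
      simp only [map_add] at hz hw ⊢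
      exact hz.add hw
    | tmul x y =>
      have hfd := B.locallyFinite y
      set S := Submodule.span ℂ (Set.range fun k : UnitaryK n => B.kAct k y) with hS
      set S' := S ⊔ Submodule.span ℂ {B.gAct E y} with hS'
      have hfd' : FiniteDimensional ℂ S' := Submodule.finiteDimensional_sup _ _
      let b := Module.finBasis ℂ S'
      have hext : ∀ j, ∃ ψ : Module.Dual ℂ Y, ψ ∘ₗ S'.subtype = b.coord j :=
        fun j => LinearMap.exists_extend _
      choose ψ hψ using hext
      have hexp : ∀ w ∈ S', w = ∑ j, ψ j w • (b j : Y) := by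
        intro w hw
        have h1 := congrArg (Subtype.val) (b.sum_repr ⟨w, hw⟩)
        have h2 : ∀ j, ψ j w = b.repr ⟨w, hw⟩ j := fun j =>
          LinearMap.congr_fun (hψ j) ⟨w, hw⟩
        simp only [h2]
        simpa only [Submodule.coe_sum, Submodule.coe_smul] using h1.symm
      have hmem : ∀ k, B.kAct k y ∈ S' := fun k =>
        Submodule.mem_sup_left (Submodule.subset_span ⟨k, rfl⟩)
      have hmem' : B.gAct E y ∈ S' :=
        Submodule.mem_sup_right (Submodule.subset_span rfl)
      have hφ : ∀ x' : X, ∀ w ∈ S', φ (x' ⊗ₜ w) = ∑ j, ψ j w * φ (x' ⊗ₜ (b j : Y)) := by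
        intro x' w hw
        conv_lhs => rw [hexp w hw]
        simp [TensorProduct.tmul_sum]
      have h0 := one_of_curve hc
      have hy : y ∈ S' := by simpa using hmem 1
      have key : HasDerivAt
          (fun t : ℝ => ∑ j, ψ j (B.kAct (c t) y) * φ (A.kAct (c t) x ⊗ₜ (b j : Y)))
          (∑ j, (ψ j (B.gAct E y) * φ (x ⊗ₜ (b j : Y)) + ψ j y * φ (A.gAct E x ⊗ₜ (b j : Y)))) 0 := by
        apply HasDerivAt.fun_sum
        intro j _
        have hB := B.differential E c hc y (ψ j)
        have hA := A.differential E c hc x (φ ∘ₗ (TensorProduct.mk ℂ X Y).flip (b j : Y))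
        have := hB.mul hA
        simp only [h0, map_one] at this
        exact this
      rw [Finset.sum_add_distrib, ← hφ x _ hmem', ← hφ _ _ hy] at key
      simp only [Representation.tprod_apply, TensorProduct.map_tmul, LinearMap.add_apply, map_add,
        LinearMap.id_apply]
      rw [add_comm]
      refine key.congr_of_eventuallyEq (Filter.Eventually.of_forall fun t => ?_)
      exact hφ _ _ (hmem _)

end GKModule

variable {n : ℕ} {W : Type*} [NormedAddCommGroup W] [NormedSpace ℂ W]

/-- The real Lie group `G = GL(n, ℂ)`. -/
abbrev G (n : ℕ) : Type := GL (Fin n) ℂ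

/-- The matrices as a normed space (with the norm of a finite product of copies of `ℂ`). -/
abbrev Mat (n : ℕ) : Type := Fin n → Fin n → ℂ

/-- The entries of an invertible matrix. -/
def entries (g : G n) : Mat n := fun i j => (g : Gl n) i j

/-- A function on `G`, extended by zero to the space of all matrices. -/
def ext (f : G n → W) : Mat n → W := Function.extend entries f 0

/-- `f : G → W` is smooth for the real manifold structure of `G` as an open subset of the space of
matrices. -/
def IsSmooth (f : G n → W) : Prop := ContDiffOn ℝ ∞ (ext f) (Set.range entries)

/-- The inclusion `K → G`. -/
def ofK : UnitaryK n →* G n := Unitary.toUnits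

/-- The exponential map `𝔤₀ → G`. -/
def expG (E : Gl n) : G n := (Matrix.isUnit_exp E).unit

/-- Right translation: `(h · f) g = f (g h)`. -/
def rightTranslate (h : G n) (f : G n → W) : G n → W := fun g => f (g * h)

/-- `f` is `K`-finite under right translation. -/
def IsKFinite (f : G n → W) : Prop :=
  FiniteDimensional ℂ (Submodule.span ℂ (Set.range fun k : UnitaryK n => rightTranslate (ofK k) f))

/-- The derivative of right translation: `(E · f) g = d/dt f (g exp (t E))` at `t = 0`. -/
def lieDeriv (E : Gl n) (f : G n → W) : G n → W :=
  fun g => deriv (fun t : ℝ => f (g * expG (t • E))) 0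

lemma entries_injective : Function.Injective (entries (n := n)) :=
  fun _ _ h => Units.ext h

lemma ext_entries {W : Type*} [NormedAddCommGroup W] (f : G n → W) (g : G n) :
    ext f (entries g) = f g :=
  entries_injective.extend_apply _ _ _

lemma range_entries : Set.range (entries (n := n)) = {A | (Matrix.of A).det ≠ 0} := by
  ext A
  constructor
  · rintro ⟨g, rfl⟩
    exact ((Matrix.isUnit_iff_isUnit_det _).1 g.isUnit).ne_zero
  · intro h
    exact ⟨Matrix.GeneralLinearGroup.mkOfDetNeZero (Matrix.of A) h, rfl⟩

lemma isOpen_range : IsOpen (Set.range (entries (n := n))) := by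
  rw [range_entries]
  exact isOpen_ne_fun (Continuous.matrix_det (continuous_id (X := Mat n))) continuous_const

lemma range_mem_nhds (g : G n) : Set.range (entries (n := n)) ∈ nhds (entries g) :=
  isOpen_range.mem_nhds ⟨g, rfl⟩

/-- Right multiplication by a matrix, as a continuous linear map. -/
def mulR (E : Gl n) : Mat n →L[ℝ] Mat n :=
  LinearMap.toContinuousLinearMap
    { toFun := fun A => fun i j => (Matrix.of A * E) i j
      map_add' := fun A B => by
        funext i j
        simp [Matrix.mul_apply, add_mul, Finset.sum_add_distrib]
      map_smul' := fun r A => by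
        funext i j
        simp [Matrix.mul_apply, Finset.mul_sum, mul_assoc] }

lemma mulR_apply (E : Gl n) (A : Mat n) (i j : Fin n) : mulR E A i j = ∑ k, A i k * E k j := rfl

lemma mulR_entries (h g : G n) : mulR (h : Gl n) (entries g) = entries (g * h) := rfl

lemma mulR_mulR (E E' : Gl n) (A : Mat n) : mulR E' (mulR E A) = mulR (E * E') A := by
  have h : ∀ (B : Gl n) (C : Mat n), mulR B C = fun i j => (Matrix.of C * B) i j := fun _ _ => rfl
  rw [h (E * E'), ← mul_assoc]
  rfl

lemma mulR_add (E E' : Gl n) (A : Mat n) : mulR (E + E') A = mulR E A + mulR E' A := by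
  funext i j
  simp [mulR_apply, mul_add, Finset.sum_add_distrib]

lemma mulR_sub (E E' : Gl n) (A : Mat n) : mulR (E - E') A = mulR E A - mulR E' A := by
  funext i j
  simp [mulR_apply, mul_sub, Finset.sum_sub_distrib]

lemma mulR_smul (r : ℝ) (E : Gl n) (A : Mat n) : mulR (r • E) A = r • mulR E A := by
  funext i j
  simp [mulR_apply, Finset.mul_sum, mul_left_comm]

lemma coe_expG (E : Gl n) : (expG E : Gl n) = NormedSpace.exp E := rfl

lemma expG_zero (E : Gl n) : expG ((0 : ℝ) • E) = 1 := by
  apply Units.ext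
  simp [coe_expG]

lemma coe_ofK (k : UnitaryK n) : (ofK k : Gl n) = k := rfl

lemma IsSmooth.contDiffAt {f : G n → W} (hf : IsSmooth f) (g : G n) :
    ContDiffAt ℝ ∞ (ext f) (entries g) :=
  ContDiffOn.contDiffAt hf (range_mem_nhds g)

lemma IsSmooth.differentiableAt {f : G n → W} (hf : IsSmooth f) (g : G n) :
    DifferentiableAt ℝ (ext f) (entries g) :=
  (hf.contDiffAt g).differentiableAt (by simp)

open scoped Matrix.Norms.Operator in
lemma hasDerivAt_exp_entry (E : Gl n) (i j : Fin n) :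
    HasDerivAt (fun t : ℝ => (NormedSpace.exp (t • E) : Gl n) i j) (E i j) 0 := by
  have h := hasDerivAt_exp_smul_const (𝕂 := ℝ) E 0
  have h2 := ((Matrix.entryLinearMap ℝ ℂ i j).toContinuousLinearMap.hasFDerivAt
    (x := NormedSpace.exp ((0 : ℝ) • E))).comp_hasDerivAt (0 : ℝ) h
  simpa using! h2

lemma hasDerivAt_curve (g : G n) (E : Gl n) :
    HasDerivAt (fun t : ℝ => entries (g * expG (t • E))) (mulR E (entries g)) 0 := by
  rw [hasDerivAt_pi]
  intro i
  rw [hasDerivAt_pi]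
  intro j
  have : HasDerivAt (fun t : ℝ => ∑ k, (g : Gl n) i k * (NormedSpace.exp (t • E) : Gl n) k j)
      (∑ k, (g : Gl n) i k * E k j) 0 :=
    HasDerivAt.fun_sum fun k _ => (hasDerivAt_exp_entry E k j).const_mul _
  exact this

lemma IsSmooth.hasDerivAt {f : G n → W} (hf : IsSmooth f) (E : Gl n) (g : G n) :
    HasDerivAt (fun t : ℝ => f (g * expG (t • E)))
      (fderiv ℝ (ext f) (entries g) (mulR E (entries g))) 0 := by
  have h2 : HasFDerivAt (ext f) (fderiv ℝ (ext f) (entries g))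
      (entries (g * expG ((0 : ℝ) • E))) := by
    rw [expG_zero, mul_one]; exact (hf.differentiableAt g).hasFDerivAt
  have h3 := h2.comp_hasDerivAt (0 : ℝ) (hasDerivAt_curve g E)
  simpa only [Function.comp_def, ext_entries] using h3

lemma IsSmooth.lieDeriv_apply {f : G n → W} (hf : IsSmooth f) (E : Gl n) (g : G n) :
    lieDeriv E f g = fderiv ℝ (ext f) (entries g) (mulR E (entries g)) :=
  (hf.hasDerivAt E g).deriv

lemma IsSmooth.hasDerivAt' {f : G n → W} (hf : IsSmooth f) (E : Gl n) (g : G n) :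
    HasDerivAt (fun t : ℝ => f (g * expG (t • E))) (lieDeriv E f g) 0 :=
  (hf.hasDerivAt E g).differentiableAt.hasDerivAt

lemma IsSmooth.ext_lieDeriv {f : G n → W} (hf : IsSmooth f) (E : Gl n) :
    Set.EqOn (ext (lieDeriv E f)) (fun A => fderiv ℝ (ext f) A (mulR E A)) (Set.range entries) := by
  rintro _ ⟨g, rfl⟩
  simp only [ext_entries, hf.lieDeriv_apply]

lemma IsSmooth.lieDeriv {f : G n → W} (hf : IsSmooth f) (E : Gl n) : IsSmooth (lieDeriv E f) := by
  refine ContDiffOn.congr ?_ (hf.ext_lieDeriv E)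
  have h1 : ContDiffOn ℝ ∞ (fderiv ℝ (ext f)) (Set.range entries) :=
    ContDiffOn.fderiv_of_isOpen hf isOpen_range (by simp)
  exact h1.clm_apply (mulR E).contDiff.contDiffOn

lemma ext_add {W : Type*} [NormedAddCommGroup W] (f f' : G n → W) : Set.EqOn (ext (f + f')) (ext f + ext f') (Set.range entries) := by
  rintro _ ⟨g, rfl⟩
  simp [ext_entries]

lemma ext_smul (c : ℂ) (f : G n → W) : Set.EqOn (ext (c • f)) (c • ext f) (Set.range entries) := by
  rintro _ ⟨g, rfl⟩
  simp [ext_entries]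

lemma IsSmooth.add {f f' : G n → W} (hf : IsSmooth f) (hf' : IsSmooth f') : IsSmooth (f + f') :=
  (ContDiffOn.add hf hf').congr (ext_add f f')

lemma IsSmooth.smul {f : G n → W} (c : ℂ) (hf : IsSmooth f) : IsSmooth (c • f) :=
  (ContDiffOn.const_smul c hf).congr (ext_smul c f)

lemma IsSmooth.zero : IsSmooth (0 : G n → W) := by
  refine contDiffOn_const (c := (0 : W)) |>.congr ?_
  rintro _ ⟨g, rfl⟩
  simp [ext_entries]

lemma IsSmooth.rightTranslate {f : G n → W} (hf : IsSmooth f) (h : G n) :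
    IsSmooth (rightTranslate h f) := by
  have h1 : ContDiffOn ℝ ∞ (fun A => ext f (mulR (h : Gl n) A)) (Set.range entries) :=
    ContDiffOn.comp (t := Set.range entries) hf (mulR (h : Gl n)).contDiff.contDiffOn (by
      rintro _ ⟨g, rfl⟩
      exact ⟨g * h, rfl⟩)
  refine h1.congr ?_
  rintro _ ⟨g, rfl⟩
  rw [mulR_entries, ext_entries, ext_entries]
  rfl

/-- The smooth functions `G → W`. -/
def smoothFunctions (n : ℕ) (W : Type*) [NormedAddCommGroup W] [NormedSpace ℂ W] :
    Submodule ℂ (G n → W) where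
  carrier := {f | IsSmooth f}
  add_mem' := IsSmooth.add
  zero_mem' := IsSmooth.zero
  smul_mem' c _ hf := hf.smul c

lemma lieDeriv_add (E : Gl n) {f f' : G n → W} (hf : IsSmooth f) (hf' : IsSmooth f') :
    lieDeriv E (f + f') = lieDeriv E f + lieDeriv E f' :=
  funext fun g => ((hf.hasDerivAt' E g).add (hf'.hasDerivAt' E g)).deriv

lemma lieDeriv_smul (E : Gl n) (c : ℂ) {f : G n → W} (hf : IsSmooth f) :
    lieDeriv E (c • f) = c • lieDeriv E f :=
  funext fun g => ((hf.hasDerivAt' E g).const_smul c).deriv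

lemma lieDeriv_add_left (E E' : Gl n) {f : G n → W} (hf : IsSmooth f) :
    lieDeriv (E + E') f = lieDeriv E f + lieDeriv E' f := by
  funext g
  simp [hf.lieDeriv_apply, mulR_add]

lemma lieDeriv_smul_left (r : ℝ) (E : Gl n) {f : G n → W} (hf : IsSmooth f) :
    lieDeriv (r • E) f = (r : ℂ) • lieDeriv E f := by
  funext g
  simp [hf.lieDeriv_apply, mulR_smul]

lemma lieDeriv_lieDeriv (E E' : Gl n) {f : G n → W} (hf : IsSmooth f) (g : G n) :
    lieDeriv E (lieDeriv E' f) g =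
      fderiv ℝ (fderiv ℝ (ext f)) (entries g) (mulR E (entries g)) (mulR E' (entries g)) +
        fderiv ℝ (ext f) (entries g) (mulR (E * E') (entries g)) := by
  rw [(hf.lieDeriv E').lieDeriv_apply]
  have h1 : ext (lieDeriv E' f) =ᶠ[nhds (entries g)] fun A => fderiv ℝ (ext f) A (mulR E' A) :=
    Filter.eventuallyEq_of_mem (range_mem_nhds g) (hf.ext_lieDeriv E')
  rw [h1.fderiv_eq]
  have h2 : DifferentiableAt ℝ (fderiv ℝ (ext f)) (entries g) :=
    ((hf.contDiffAt g).fderiv_right (m := ∞) (by simp)).differentiableAt (by simp)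
  rw [(h2.hasFDerivAt.clm_apply (mulR E').hasFDerivAt).fderiv]
  simp [add_comm, mulR_mulR]

lemma lieDeriv_bracket (E E' : Gl n) {f : G n → W} (hf : IsSmooth f) :
    lieDeriv (E * E' - E' * E) f = lieDeriv E (lieDeriv E' f) - lieDeriv E' (lieDeriv E f) := by
  funext g
  have hs : IsSymmSndFDerivAt ℝ (ext f) (entries g) :=
    (hf.contDiffAt g).isSymmSndFDerivAt
      (by simpa using WithTop.coe_le_coe.2 (le_top : (2 : ℕ∞) ≤ ⊤))
  rw [Pi.sub_apply, lieDeriv_lieDeriv E E' hf, lieDeriv_lieDeriv E' E hf, hf.lieDeriv_apply,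
    hs.eq (mulR E (entries g)), mulR_sub, map_sub]
  abel

lemma expG_conj (h : G n) (E : Gl n) : h * expG E = expG ((h : Gl n) * E * ((h⁻¹ : G n) : Gl n)) * h := by
  apply Units.ext
  have := Matrix.exp_units_conj h E
  rw [Units.val_mul, Units.val_mul, coe_expG, coe_expG, this]
  simp [mul_assoc]

lemma rightTranslate_lieDeriv (h : G n) (E : Gl n) (f : G n → W) :
    rightTranslate h (lieDeriv E f) =
      lieDeriv ((h : Gl n) * E * ((h⁻¹ : G n) : Gl n)) (rightTranslate h f) := by
  funext g
  simp only [rightTranslate, lieDeriv]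
  congr 1
  funext t
  rw [mul_assoc, mul_assoc, expG_conj]
  simp only [smul_mul_assoc, mul_smul_comm]

lemma coe_ofK_inv (k : UnitaryK n) : (((ofK k)⁻¹ : G n) : Gl n) = star (k : Gl n) := rfl

lemma IsKFinite.lieDeriv {f : G n → W} (hk : IsKFinite f) (hf : IsSmooth f) (E : Gl n) :
    IsKFinite (lieDeriv E f) := by
  classical
  let L : Gl n →ₗ[ℝ] (smoothFunctions n W) →ₗ[ℝ] (G n → W) :=
    LinearMap.mk₂ ℝ (fun E f => GLComplex.lieDeriv E f.1)
      (fun E E' f => lieDeriv_add_left E E' f.2)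
      (fun r E f => (lieDeriv_smul_left r E f.2).trans (Complex.coe_smul _ _))
      (fun E f f' => lieDeriv_add E f.2 f'.2)
      (fun r E f => ((congrArg _ (Complex.coe_smul r f.1).symm).trans
        (lieDeriv_smul E r f.2)).trans (Complex.coe_smul _ _))
  let S : Submodule ℂ (smoothFunctions n W) := Submodule.span ℂ
    (Set.range fun k : UnitaryK n => (⟨rightTranslate (ofK k) f, hf.rightTranslate _⟩ :
      smoothFunctions n W))
  have e := Submodule.equivMapOfInjective (smoothFunctions n W).subtype
    (smoothFunctions n W).injective_subtype S
  have hS : S.map (smoothFunctions n W).subtype =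
      Submodule.span ℂ (Set.range fun k : UnitaryK n => rightTranslate (ofK k) f) := by
    rw [Submodule.map_span, ← Set.range_comp]
    rfl
  rw [hS] at e
  have hfd : FiniteDimensional ℂ S := @LinearEquiv.finiteDimensional _ _ _ _ _ _ _ _ e.symm hk
  have hfdR : FiniteDimensional ℝ (S.restrictScalars ℝ) := FiniteDimensional.complexToReal S
  have h3 := (Module.Finite.fg_top (R := ℝ) (M := Gl n)).map₂ L (Module.Finite.iff_fg.1 hfdR)
  obtain ⟨s, hs⟩ := h3
  refine Submodule.finiteDimensional_of_le (S₂ := Submodule.span ℂ (s : Set (G n → W))) ?_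
  rw [Submodule.span_le]
  rintro _ ⟨k, rfl⟩
  have h4 : L ((ofK k : Gl n) * E * (((ofK k)⁻¹ : G n) : Gl n))
      ⟨rightTranslate (ofK k) f, hf.rightTranslate _⟩ ∈ Submodule.span ℝ (s : Set (G n → W)) := by
    rw [hs]
    exact Submodule.apply_mem_map₂ _ Submodule.mem_top (Submodule.subset_span ⟨k, rfl⟩)
  have h5 := Submodule.span_le_restrictScalars ℝ ℂ (s : Set (G n → W)) h4
  simp only [rightTranslate_lieDeriv]
  exact h5

lemma IsKFinite.rightTranslate {f : G n → W} (hf : IsKFinite f) (k : UnitaryK n) :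
    IsKFinite (rightTranslate (ofK k) f) := by
  refine finiteDimensional_of_le hf ?_
  rw [Submodule.span_le]
  rintro _ ⟨k', rfl⟩
  refine Submodule.subset_span ⟨k' * k, ?_⟩
  funext g
  simp [GLComplex.rightTranslate, mul_assoc]

lemma IsKFinite.zero : IsKFinite (0 : G n → W) := by
  refine finiteDimensional_of_le (T := (⊥ : Submodule ℂ (G n → W)))
    (inferInstance : FiniteDimensional ℂ (⊥ : Submodule ℂ (G n → W))) ?_
  rw [Submodule.span_le]
  rintro _ ⟨k', rfl⟩
  rfl

lemma IsKFinite.add {f f' : G n → W} (hf : IsKFinite f) (hf' : IsKFinite f') :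
    IsKFinite (f + f') := by
  have h1 : FiniteDimensional ℂ
    (Submodule.span ℂ (Set.range fun k : UnitaryK n => GLComplex.rightTranslate (ofK k) f)) := hf
  have h2 : FiniteDimensional ℂ
    (Submodule.span ℂ (Set.range fun k : UnitaryK n => GLComplex.rightTranslate (ofK k) f')) := hf'
  have h3 := @Submodule.finiteDimensional_sup _ _ _ _ _ _ _ h1 h2
  refine finiteDimensional_of_le h3 (Submodule.span_le.2 ?_)
  rintro _ ⟨k, rfl⟩
  exact Submodule.add_mem_sup (Submodule.subset_span ⟨k, rfl⟩) (Submodule.subset_span ⟨k, rfl⟩)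

lemma IsKFinite.smul {f : G n → W} (c : ℂ) (hf : IsKFinite f) : IsKFinite (c • f) := by
  refine finiteDimensional_of_le hf (Submodule.span_le.2 ?_)
  rintro _ ⟨k, rfl⟩
  exact Submodule.smul_mem _ c (Submodule.subset_span ⟨k, rfl⟩)

/-- The Borel subgroup `B` of upper triangular matrices. -/
def borel (n : ℕ) : Subgroup (G n) where
  carrier := {b | (b : Gl n).BlockTriangular id}
  one_mem' := Matrix.blockTriangular_one
  mul_mem' ha hb := Matrix.BlockTriangular.mul ha hb
  inv_mem' {b} hb := by
    have : Invertible (b : Gl n) := b.invertible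
    have h := Matrix.blockTriangular_inv_of_blockTriangular (M := (b : Gl n)) hb
    rwa [← Matrix.coe_units_inv] at h

lemma borel_mul_diag {a b : G n} (ha : a ∈ borel n) (hb : b ∈ borel n) (i : Fin n) :
    (a * b : G n) i i = a i i * b i i := by
  rw [Units.val_mul, Matrix.mul_apply, Finset.sum_eq_single i]
  · intro j _ hj
    rcases lt_or_gt_of_ne hj with h | h
    · rw [ha h, zero_mul]
    · rw [hb h, mul_zero]
  · simp

lemma borel_diag_ne_zero {b : G n} (hb : b ∈ borel n) (i : Fin n) : b i i ≠ 0 := by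
  intro h
  have h1 := borel_mul_diag hb (inv_mem hb) i
  rw [h, zero_mul, mul_inv_cancel] at h1
  simp at h1

/-- The modular character of `B` (the ratio by which `Ad b` scales Haar measure on the unipotent
radical): `δ(b) = ∏ |b_i|^{2 (n + 1 - 2 i)}` for diagonal entries `b_1, …, b_n`. The index
`i : Fin n` below starts at `0`. -/
def modular (b : G n) : ℝ := ∏ i : Fin n, ‖b i i‖ ^ (2 * ((n : ℤ) - 1 - 2 * (i : ℤ)))

/-- The space of smooth `K`-finite functions `f : G → W` with `f (b g) = δ(b)^{1/2} τ(b) f(g)` for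
`b ∈ B`, where `τ` is a representation of `B` on `W`. -/
def IndSpace (τ : Representation ℂ (borel n) W) : Submodule ℂ (G n → W) where
  carrier := {f | IsSmooth f ∧ IsKFinite f ∧
    ∀ (b : borel n) (g : G n), f (b * g) = (Real.sqrt (modular (b : G n)) : ℂ) • τ b (f g)}
  add_mem' ha hb := ⟨ha.1.add hb.1, ha.2.1.add hb.2.1, fun b g => by
    simp only [Pi.add_apply, ha.2.2, hb.2.2, map_add, smul_add]⟩
  zero_mem' := ⟨IsSmooth.zero, IsKFinite.zero, fun b g => by simp⟩
  smul_mem' c f hf := ⟨hf.1.smul c, hf.2.1.smul c, fun b g => by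
    simp only [Pi.smul_apply, hf.2.2, map_smul]
    rw [smul_comm]⟩

section

variable [FiniteDimensional ℂ W]

lemma IndSpace.lieDeriv_mem (τ : Representation ℂ (borel n) W) (E : Gl n) {f : G n → W}
    (hf : f ∈ IndSpace τ) : lieDeriv E f ∈ IndSpace τ := by
  refine ⟨hf.1.lieDeriv E, hf.2.1.lieDeriv hf.1 E, fun b g => ?_⟩
  let T : W →L[ℝ] W := (LinearMap.toContinuousLinearMap (τ b)).restrictScalars ℝ
  have h1 := (T.hasFDerivAt.comp_hasDerivAt (0 : ℝ) (hf.1.hasDerivAt' E g)).const_smul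
    (Real.sqrt (modular (b : G n)) : ℂ)
  refine (h1.congr_of_eventuallyEq (Filter.Eventually.of_forall fun t => ?_)).deriv
  have := hf.2.2 b (g * expG (t • E))
  rw [← mul_assoc] at this
  exact this

/-- Linear functionals on a finite dimensional space of functions are combinations of point
evaluations; hence differentiability of a curve in it can be tested pointwise. -/
lemma hasDerivAt_of_pointwise (S : Submodule ℂ (G n → W)) [FiniteDimensional ℂ S]
    (c : ℝ → S) (c' : S)
    (h : ∀ g, HasDerivAt (fun t : ℝ => (c t : G n → W) g) ((c' : G n → W) g) 0)
    (φ : Module.Dual ℂ S) : HasDerivAt (fun t : ℝ => φ (c t)) (φ c') 0 := by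
  let D : Submodule ℂ (Module.Dual ℂ S) :=
    { carrier := {φ | HasDerivAt (fun t : ℝ => φ (c t)) (φ c') 0}
      add_mem' := fun ha hb => HasDerivAt.add ha hb
      zero_mem' := by simpa using! hasDerivAt_const (0 : ℝ) (0 : ℂ)
      smul_mem' := fun r ψ hψ => by
        simpa using! HasDerivAt.const_mul r hψ }
  have hD : D = ⊤ := by
    have h1 : D.dualCoannihilator = ⊥ := by
      rw [eq_bot_iff]
      intro s hs
      rw [Submodule.mem_dualCoannihilator] at hs
      have h2 : ∀ (g : G n) (ψ : Module.Dual ℂ W), ψ ((s : G n → W) g) = 0 := by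
        intro g ψ
        refine hs (ψ ∘ₗ LinearMap.proj g ∘ₗ S.subtype) ?_
        exact ((LinearMap.toContinuousLinearMap ψ).restrictScalars
          ℝ).hasFDerivAt.comp_hasDerivAt (0 : ℝ) (h g)
      rw [Submodule.mem_bot]
      apply Subtype.ext
      funext g
      exact (Module.forall_dual_apply_eq_zero_iff ℂ _).1 (h2 g)
    have h3 := Subspace.dualCoannihilator_dualAnnihilator_eq (W := D)
    rw [h1, Submodule.dualAnnihilator_bot] at h3
    exact h3.symm
  exact (hD ▸ Submodule.mem_top : φ ∈ D)

lemma ofK_curve {E : Gl n} {c : ℝ → UnitaryK n}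
    (hc : ∀ t : ℝ, (c t : Gl n) = NormedSpace.exp (t • E)) (t : ℝ) : ofK (c t) = expG (t • E) :=
  Units.ext (hc t)

/-- The `(𝔤, K)`-module `Ind_B^G τ` (normalized parabolic induction), acting by right translation
and its derivative. -/
def ind (τ : Representation ℂ (borel n) W) : GKModule n (IndSpace τ) where
  kAct :=
    { toFun := fun k =>
        { toFun := fun f => ⟨rightTranslate (ofK k) f.1, f.2.1.rightTranslate _,
            f.2.2.1.rightTranslate k, fun b g => by
              simpa only [rightTranslate, mul_assoc] using f.2.2.2 b (g * ofK k)⟩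
          map_add' := fun _ _ => rfl
          map_smul' := fun _ _ => rfl }
      map_one' := by
        ext f g
        simp [rightTranslate]
      map_mul' := fun k k' => by
        ext f g
        change f.1 (g * ofK (k * k')) = f.1 (g * ofK k * ofK k')
        rw [map_mul, mul_assoc] }
  gAct E :=
    { toFun := fun f => ⟨lieDeriv E f.1, IndSpace.lieDeriv_mem τ E f.2⟩
      map_add' := fun f f' => Subtype.ext (lieDeriv_add E f.2.1 f'.2.1)
      map_smul' := fun r f => Subtype.ext (lieDeriv_smul E r f.2.1) }
  gAct_add E E' := LinearMap.ext fun f => Subtype.ext (lieDeriv_add_left E E' f.2.1)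
  gAct_smul r E := LinearMap.ext fun f => Subtype.ext (lieDeriv_smul_left r E f.2.1)
  gAct_lie E E' := LinearMap.ext fun f => Subtype.ext (lieDeriv_bracket E E' f.2.1)
  locallyFinite f := by
    have e := Submodule.equivMapOfInjective (IndSpace τ).subtype (IndSpace τ).injective_subtype
      (Submodule.span ℂ (Set.range fun k : UnitaryK n =>
        (⟨rightTranslate (ofK k) f.1, f.2.1.rightTranslate _,
            f.2.2.1.rightTranslate k, fun b g => by
              simpa only [rightTranslate, mul_assoc] using f.2.2.2 b (g * ofK k)⟩ : IndSpace τ)))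
    rw [Submodule.map_span, ← Set.range_comp] at e
    exact @LinearEquiv.finiteDimensional _ _ _ _ _ _ _ _ e.symm f.2.2.1
  adjoint k E f := Subtype.ext (rightTranslate_lieDeriv (ofK k) E f.1)
  differential E c hc f φ := by
    have hfin : FiniteDimensional ℂ (Submodule.span ℂ
      (Set.range fun k : UnitaryK n => rightTranslate (ofK k) f.1)) := f.2.2.1
    let S : Submodule ℂ (G n → W) := Submodule.span ℂ
      (Set.range fun k : UnitaryK n => rightTranslate (ofK k) f.1) ⊔
        Submodule.span ℂ {lieDeriv E f.1}
    have hS : FiniteDimensional ℂ S := Submodule.finiteDimensional_sup _ _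
    obtain ⟨ψ, hψ⟩ := LinearMap.exists_extend (p := IndSpace τ) φ
    have hφ : ∀ x : IndSpace τ, φ x = ψ x.1 := fun x => (LinearMap.congr_fun hψ x).symm
    simp only [hφ]
    exact hasDerivAt_of_pointwise S
      (fun t => ⟨rightTranslate (ofK (c t)) f.1,
        Submodule.mem_sup_left (Submodule.subset_span ⟨c t, rfl⟩)⟩)
      ⟨lieDeriv E f.1, Submodule.mem_sup_right (Submodule.subset_span rfl)⟩
      (fun g => by simpa only [rightTranslate, ofK_curve hc] using f.2.1.hasDerivAt' E g)
      (ψ ∘ₗ S.subtype)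

end

/-- A weight `λ = (λ_L, λ_R)` of `𝔥 ≅ 𝔥₀ × 𝔥₀` such that `μ = λ_L - λ_R` is integral. -/
structure Weight (n : ℕ) where
  L : Fin n → ℂ
  R : Fin n → ℂ
  integral : ∀ i, ∃ m : ℤ, L i - R i = m

/-- The weight `(λ_L, λ_R + e_k)`. -/
def Weight.addR (lam : Weight n) (k : Fin n) : Weight n where
  L := lam.L
  R := lam.R + Pi.single k 1
  integral i := by
    obtain ⟨m, hm⟩ := lam.integral i
    by_cases h : i = k
    · subst h
      refine ⟨m - 1, ?_⟩
      push_cast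
      rw [← hm]
      simp
      ring
    · exact ⟨m, by simp [h, hm]⟩

/-- `z^a \bar z^b` for `z ≠ 0`, that is `|z|^{a + b} (z / |z|)^{a - b}`; independent of the branch
of the logarithm when `a - b` is an integer. -/
def cpowConj (a b z : ℂ) : ℂ := Complex.exp (a * Complex.log z + b * conj (Complex.log z))

lemma cpowConj_one (a b : ℂ) : cpowConj a b 1 = 1 := by simp [cpowConj]

lemma cpowConj_mul {a b : ℂ} (h : ∃ m : ℤ, a - b = m) {z w : ℂ} (hz : z ≠ 0) (hw : w ≠ 0) :
    cpowConj a b (z * w) = cpowConj a b z * cpowConj a b w := by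
  obtain ⟨m, hm⟩ := h
  have h1 : Complex.exp (Complex.log (z * w)) = Complex.exp (Complex.log z + Complex.log w) := by
    rw [Complex.exp_add, Complex.exp_log hz, Complex.exp_log hw, Complex.exp_log (mul_ne_zero hz hw)]
  obtain ⟨k, hk⟩ := Complex.exp_eq_exp_iff_exists_int.1 h1
  rw [cpowConj, cpowConj, cpowConj, ← Complex.exp_add, Complex.exp_eq_exp_iff_exists_int]
  refine ⟨m * k, ?_⟩
  rw [hk]
  simp only [map_add, map_mul, Complex.conj_I, Complex.conj_ofReal, map_intCast, map_ofNat]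
  push_cast
  rw [← hm]
  ring

/-- The character `λ(b) = ∏ b_i^{λ_{L,i}} \bar b_i^{λ_{R,i}}` of `B`; its differential on the
diagonal matrices `H`, embedded in `𝔥` as `(H, \bar H)`, is `λ`. -/
def Weight.character (lam : Weight n) : borel n →* ℂ where
  toFun b := ∏ i, cpowConj (lam.L i) (lam.R i) ((b : G n) i i)
  map_one' := by simp [cpowConj_one]
  map_mul' a b := by
    rw [← Finset.prod_mul_distrib]
    refine Finset.prod_congr rfl fun i _ => ?_
    rw [Subgroup.coe_mul, borel_mul_diag a.2 b.2, cpowConj_mul (lam.integral i)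
      (borel_diag_ne_zero a.2 i) (borel_diag_ne_zero b.2 i)]

/-- The representation `ℂ_λ ⊗ τ` of `B`, on the space of `τ`. -/
def Weight.twist (lam : Weight n) {W : Type*} [AddCommGroup W] [Module ℂ W]
    (τ : Representation ℂ (borel n) W) : Representation ℂ (borel n) W where
  toFun b := lam.character b • τ b
  map_one' := by simp
  map_mul' a b := by
    rw [map_mul, map_mul, smul_mul_smul_comm]

/-- The one-dimensional representation `ℂ_λ` of `B`. -/
def Weight.line (lam : Weight n) : Representation ℂ (borel n) ℂ :=
  lam.twist (Representation.trivial ℂ (borel n) ℂ)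

/-- The principal series `X(λ) = Ind_B^G ℂ_λ`, as a `(𝔤, K)`-module. -/
def principalSeries (lam : Weight n) : GKModule n (IndSpace lam.line) := ind lam.line

/-- The conjugate standard representation of `G` on `V = ℂ^n`: `g v = \bar g v`. -/
def conjStdRep (n : ℕ) : Representation ℂ (G n) (Fin n → ℂ) where
  toFun g := Matrix.mulVecLin ((g : Gl n).map (starRingEnd ℂ))
  map_one' := by
    rw [Units.val_one, Matrix.map_one _ (map_zero _) (map_one _), Matrix.mulVecLin_one]
    rfl
  map_mul' g h := by
    rw [Units.val_mul, Matrix.map_mul, Matrix.mulVecLin_mul]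
    rfl

/-- The conjugate standard representation `V` as a `(𝔤, K)`-module. -/
def conjStd (n : ℕ) : GKModule n (Fin n → ℂ) where
  kAct := (conjStdRep n).comp ofK
  gAct E := Matrix.mulVecLin (E.map (starRingEnd ℂ))
  gAct_add E E' := by
    rw [Matrix.map_add _ (map_add _), Matrix.mulVecLin_add]
  gAct_smul r E := by
    refine LinearMap.ext fun v => funext fun i => ?_
    simp [Matrix.mulVec, dotProduct, Finset.mul_sum, mul_assoc]
  gAct_lie E E' := by
    rw [Matrix.map_sub _ (map_sub _), Matrix.map_mul, Matrix.map_mul]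
    refine LinearMap.ext fun v => ?_
    simp
  locallyFinite v := inferInstance
  adjoint k E v := by
    have h : (star (k : Gl n)) * k = 1 := Unitary.coe_star_mul_self k
    change ((k : Gl n).map (starRingEnd ℂ)).mulVec ((E.map (starRingEnd ℂ)).mulVec v) =
      (((k : Gl n) * E * star (k : Gl n)).map (starRingEnd ℂ)).mulVec
        (((k : Gl n).map (starRingEnd ℂ)).mulVec v)
    rw [Matrix.mulVec_mulVec, Matrix.mulVec_mulVec, ← Matrix.map_mul, ← Matrix.map_mul, mul_assoc,
      mul_assoc, h, mul_one]
  differential E c hc v φ := by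
    have h1 : HasDerivAt (fun t : ℝ => ((c t : Gl n).map (starRingEnd ℂ)).mulVec v)
        ((E.map (starRingEnd ℂ)).mulVec v) 0 := by
      rw [hasDerivAt_pi]
      intro i
      have : HasDerivAt
          (fun t : ℝ => ∑ j, conj ((NormedSpace.exp (t • E) : Gl n) i j) * v j)
          (∑ j, conj (E i j) * v j) 0 :=
        HasDerivAt.fun_sum fun j _ => ((hasDerivAt_exp_entry E i j).star).mul_const _
      simp only [hc]
      exact this
    exact ((LinearMap.toContinuousLinearMap φ).restrictScalars
      ℝ).hasFDerivAt.comp_hasDerivAt (0 : ℝ) h1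

/-- The `B`-representation `ℂ_λ ⊗ V`. -/
def Weight.lineTensorV (lam : Weight n) : Representation ℂ (borel n) (Fin n → ℂ) :=
  lam.twist ((conjStdRep n).comp (borel n).subtype)

/-- The standard flag `V_k = span {e_1, …, e_k}` of `V`: all coordinates after the first `k`
vanish. -/
def flag (n k : ℕ) : Submodule ℂ (Fin n → ℂ) where
  carrier := {v | ∀ i : Fin n, k ≤ i → v i = 0}
  add_mem' ha hb i hi := by simp [ha i hi, hb i hi]
  zero_mem' _ _ := rfl
  smul_mem' c v hv i hi := by simp [hv i hi]

end GLComplex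

end

open GLComplex

noncomputable section

namespace GLComplex

/-! ### Smooth and `K`-finite functions on `G` -/

section Smooth

variable {n : ℕ} {W W' : Type*} [NormedAddCommGroup W] [NormedSpace ℂ W]
  [NormedAddCommGroup W'] [NormedSpace ℂ W']

/-! Since `V` is a representation of all of `G`, an equivariant `F` with values in `ℂ_λ ⊗ V` can be
untwisted to `g ↦ \bar g⁻¹ F g`. Its coordinates lie in `X(λ)`, because the action of `b` on `V`
cancels and only the character remains. Expanding in the standard basis inverts the Mackey map
(`mackeyHom_bijective`). Its `𝔤`-equivariance is the Leibniz rule (`lieDeriv_mackeyFun`).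

The filtration comes from the `B`-stable flag. With indices starting at `0`, `B` acts on the line
`V_{k+1} / V_k` by `\bar b_k`, which turns `λ` into `(λ_L, λ_R + e_k)` (`character_addR`). Taking
the `k`-th coordinate therefore maps `V_{k+1}`-valued functions to `X(λ_L, λ_R + e_k)`, and its
kernel consists of the `V_k`-valued functions.

The remaining point is surjectivity, that is, exactness of induction. It is obtained from an
explicit section. Gram–Schmidt yields a smooth vector `w(g)` in `e_k + span {e_i : i < k}` such that
`g⁻¹ w(g)` is orthogonal to every `g⁻¹ e_i`, `i < k`. It is unchanged under `g ↦ g u` for unitary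
`u`, and `b w(g) = b_k w(b g)` for `b ∈ B` (`orthVec_mul_ofK`, `orthVec_borel_mul`). Hence `φ ↦ φ ·
\bar w` preserves smoothness and `K`-finiteness, has the right equivariance, and has `k`-th
coordinate `φ` (`flagCoord_surjective`). -/

lemma IsSmooth.of_eq {f : G n → W} {F : Mat n → W}
    (hF : ContDiffOn ℝ ∞ F (Set.range entries)) (h : ∀ g, f g = F (entries g)) : IsSmooth f := by
  refine ContDiffOn.congr hF ?_
  rintro _ ⟨g, rfl⟩
  rw [ext_entries, h]

lemma IsSmooth.const (c : W) : IsSmooth (fun _ : G n => c) :=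
  .of_eq contDiffOn_const fun _ => rfl

/-- Real linearity of `L` is the useful generality: complex conjugation enters both through `V` and
through the section of the coordinate map. -/
lemma IsSmooth.clm {f : G n → W} (hf : IsSmooth f) (L : W →L[ℝ] W') :
    IsSmooth (fun g => L (f g)) :=
  .of_eq (F := fun A => L (ext f A)) (L.contDiff.comp_contDiffOn hf) fun g => by
    rw [ext_entries]

lemma IsSmooth.fun_smul {f : G n → ℂ} {h : G n → W} (hf : IsSmooth f) (hh : IsSmooth h) :
    IsSmooth (fun g => f g • h g) :=
  .of_eq (F := fun A => ext f A • ext h A) (ContDiffOn.smul hf hh) fun g => by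
    simp only [ext_entries]

lemma IsSmooth.fun_mul {f h : G n → ℂ} (hf : IsSmooth f) (hh : IsSmooth h) :
    IsSmooth (fun g => f g * h g) :=
  hf.fun_smul hh

lemma IsSmooth.fun_add {f h : G n → W} (hf : IsSmooth f) (hh : IsSmooth h) :
    IsSmooth (fun g => f g + h g) :=
  hf.add hh

lemma IsSmooth.fun_sum {ι : Type*} (s : Finset ι) {f : ι → G n → W}
    (hf : ∀ i, IsSmooth (f i)) : IsSmooth (fun g => ∑ i ∈ s, f i g) := by
  have := (smoothFunctions n W).sum_mem (t := s) fun i _ => hf i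
  convert! this using 1
  ext g
  simp

lemma IsSmooth.fun_prod {ι : Type*} (s : Finset ι) {f : ι → G n → ℂ}
    (hf : ∀ i, IsSmooth (f i)) : IsSmooth (fun g => ∏ i ∈ s, f i g) := by
  classical
  induction s using Finset.induction_on with
  | empty => simpa using IsSmooth.const (1 : ℂ)
  | insert i s hi ih =>
    simp only [Finset.prod_insert hi]
    exact (hf i).fun_mul ih

lemma IsSmooth.fun_conj {f : G n → ℂ} (hf : IsSmooth f) : IsSmooth (fun g => conj (f g)) :=
  hf.clm (Complex.conjCLE : ℂ →L[ℝ] ℂ)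

lemma IsSmooth.fun_inv {f : G n → ℂ} (hf : IsSmooth f) (h0 : ∀ g, f g ≠ 0) :
    IsSmooth (fun g => (f g)⁻¹) :=
  .of_eq (F := fun A => (ext f A)⁻¹) (ContDiffOn.inv hf (by
    rintro _ ⟨g, rfl⟩
    rw [ext_entries]
    exact h0 g)) fun g => by rw [ext_entries]

lemma isSmooth_pi {m : ℕ} {f : G n → Fin m → ℂ} : IsSmooth f ↔ ∀ i, IsSmooth (fun g => f g i) := by
  constructor
  · intro hf i
    exact hf.clm (ContinuousLinearMap.proj (R := ℝ) (φ := fun _ : Fin m => ℂ) i)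
  · intro hf
    exact .of_eq (F := fun A i => ext (fun g => f g i) A) (contDiffOn_pi.2 hf) fun g => by
      funext i
      rw [ext_entries]

lemma isSmooth_entry (i j : Fin n) : IsSmooth (fun g : G n => (g : Gl n) i j) :=
  .of_eq (F := fun A => A i j) (by fun_prop) fun _ => rfl

/-- A matrix valued function on `G` with smooth entries. -/
def IsSmoothMat (A : G n → Gl n) : Prop := ∀ i j, IsSmooth fun g => A g i j

namespace IsSmoothMat

variable {A A' : G n → Gl n}

lemma coe : IsSmoothMat fun g : G n => (g : Gl n) := isSmooth_entry

lemma const (C : Gl n) : IsSmoothMat fun _ : G n => C := fun _ _ => .const _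

lemma add (hA : IsSmoothMat A) (hA' : IsSmoothMat A') : IsSmoothMat fun g => A g + A' g :=
  fun i j => (hA i j).fun_add (hA' i j)

lemma mul (hA : IsSmoothMat A) (hA' : IsSmoothMat A') : IsSmoothMat fun g => A g * A' g := by
  intro i j
  simp only [Matrix.mul_apply]
  exact .fun_sum _ fun k => (hA i k).fun_mul (hA' k j)

lemma map_conj (hA : IsSmoothMat A) : IsSmoothMat fun g => (A g).map (starRingEnd ℂ) :=
  fun i j => (hA i j).fun_conj

lemma conjTranspose (hA : IsSmoothMat A) : IsSmoothMat fun g => (A g)ᴴ :=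
  fun i j => (hA j i).fun_conj

lemma det (hA : IsSmoothMat A) : IsSmooth fun g => (A g).det := by
  simp only [Matrix.det_apply']
  exact .fun_sum _ fun σ => (IsSmooth.const _).fun_mul (.fun_prod _ fun i => hA _ _)

lemma inv (hA : IsSmoothMat A) (h0 : ∀ g, (A g).det ≠ 0) : IsSmoothMat fun g => (A g)⁻¹ := by
  intro i j
  -- Cramer's rule: an entry of the inverse is `det⁻¹` times the determinant of the matrix with one
  -- row replaced by a constant vector.
  simp only [Matrix.inv_def, Matrix.smul_apply, Matrix.adjugate_apply, Ring.inverse_eq_inv']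
  refine (hA.det.fun_inv h0).fun_smul (det fun k l => ?_)
  by_cases hk : k = j
  · subst hk
    simpa using IsSmooth.const _
  · simpa [Matrix.updateRow_apply, hk] using hA k l

lemma mulVec {f : G n → Fin n → ℂ} (hA : IsSmoothMat A) (hf : IsSmooth f) :
    IsSmooth fun g => (A g).mulVec (f g) := by
  refine isSmooth_pi.2 fun i => ?_
  simp only [Matrix.mulVec, dotProduct]
  exact .fun_sum _ fun j => (hA i j).fun_mul (isSmooth_pi.1 hf j)

lemma coe_inv : IsSmoothMat fun g : G n => ((g⁻¹ : G n) : Gl n) := by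
  simp only [Matrix.coe_units_inv]
  exact coe.inv fun g => ((Matrix.isUnit_iff_isUnit_det _).1 g.isUnit).ne_zero

end IsSmoothMat

/-- `h` is `K`-finite if its translates are obtained from those of a `K`-finite function `f` by
operators from a finite dimensional space. -/
lemma IsKFinite.of_bilinear {V' : Type*} [AddCommGroup V'] [Module ℂ V'] [FiniteDimensional ℂ V']
    (β : V' →ₗ[ℂ] (G n → W) →ₗ[ℂ] (G n → W')) (v : UnitaryK n → V') {f : G n → W} {h : G n → W'}
    (hf : IsKFinite f)
    (hh : ∀ k, GLComplex.rightTranslate (ofK k) h =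
      β (v k) (GLComplex.rightTranslate (ofK k) f)) : IsKFinite h := by
  have h3 := Module.Finite.iff_fg.2 ((Module.Finite.fg_top (R := ℂ) (M := V')).map₂ β
    (Module.Finite.iff_fg.1 hf))
  refine finiteDimensional_of_le h3 (Submodule.span_le.2 ?_)
  rintro _ ⟨k, rfl⟩
  simp only [hh]
  exact Submodule.apply_mem_map₂ _ Submodule.mem_top (Submodule.subset_span ⟨k, rfl⟩)

lemma IsKFinite.of_linear (L : (G n → W) →ₗ[ℂ] (G n → W')) {f : G n → W} {h : G n → W'}
    (hf : IsKFinite f)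
    (hh : ∀ k, GLComplex.rightTranslate (ofK k) h = L (GLComplex.rightTranslate (ofK k) f)) :
    IsKFinite h :=
  .of_bilinear ((LinearMap.lsmul ℂ _).flip L) (fun _ => (1 : ℂ)) hf fun k => by simp [hh]

lemma lieDeriv_clm (L : W →L[ℝ] W') (E : Gl n) {f : G n → W} (hf : IsSmooth f) :
    lieDeriv E (fun g => L (f g)) = fun g => L (lieDeriv E f g) :=
  funext fun g => (L.hasFDerivAt.comp_hasDerivAt (0 : ℝ) (hf.hasDerivAt' E g)).deriv

/-- Taking a coordinate commutes with the action of `𝔤`; this is used both for stability of the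
filtration and for equivariance of the quotient maps. -/
lemma lieDeriv_apply {m : ℕ} (E : Gl n) {f : G n → Fin m → ℂ} (hf : IsSmooth f) (i : Fin m)
    (g : G n) : lieDeriv E (fun g => f g i) g = lieDeriv E f g i :=
  congrFun (lieDeriv_clm (ContinuousLinearMap.proj (R := ℝ) (φ := fun _ : Fin m => ℂ) i) E hf) g

end Smooth

/-! ### The Mackey isomorphism -/

section Mackey

variable {n : ℕ}

lemma conjStdRep_inv_apply_self (g : G n) (v : Fin n → ℂ) :
    conjStdRep n g⁻¹ (conjStdRep n g v) = v := by
  simp [← Module.End.mul_apply, ← map_mul]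

lemma conjStdRep_self_apply_inv (g : G n) (v : Fin n → ℂ) :
    conjStdRep n g (conjStdRep n g⁻¹ v) = v := by
  simp [← Module.End.mul_apply, ← map_mul]

lemma IsSmooth.conjStdRep {f : G n → Fin n → ℂ} (hf : IsSmooth f) :
    IsSmooth fun g => conjStdRep n g (f g) :=
  IsSmoothMat.coe.map_conj.mulVec hf

lemma IsSmooth.conjStdRep_inv {f : G n → Fin n → ℂ} (hf : IsSmooth f) :
    IsSmooth fun g => GLComplex.conjStdRep n g⁻¹ (f g) :=
  IsSmoothMat.coe_inv.map_conj.mulVec hf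

lemma line_apply (lam : Weight n) (b : borel n) (z : ℂ) :
    lam.line b z = lam.character b * z := rfl

lemma lineTensorV_apply (lam : Weight n) (b : borel n) (v : Fin n → ℂ) :
    lam.lineTensorV b v = lam.character b • conjStdRep n b v := rfl

/-- The Mackey map on functions, `(f, v) ↦ [g ↦ f g • \bar g v]`. -/
def mackeyFun (n : ℕ) : (Fin n → ℂ) →ₗ[ℂ] (G n → ℂ) →ₗ[ℂ] (G n → Fin n → ℂ) :=
  LinearMap.mk₂ ℂ (fun v f g => f g • conjStdRep n g v)
    (fun v v' f => by ext; simp [mul_add])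
    (fun c v f => by ext; simp [mul_left_comm])
    (fun v f f' => by ext; simp [add_mul])
    (fun c v f => by ext; simp [mul_assoc])

lemma mackeyFun_apply (v : Fin n → ℂ) (f : G n → ℂ) (g : G n) :
    mackeyFun n v f g = f g • conjStdRep n g v := rfl

/-- Because conjugation is multiplicative, the new factor of `h` lands on `v`. This gives
`K`-equivariance of the Mackey map and, by bilinearity, `K`-finiteness of its values. -/
lemma rightTranslate_mackeyFun (h : G n) (v : Fin n → ℂ) (f : G n → ℂ) :
    rightTranslate h (mackeyFun n v f) = mackeyFun n (conjStdRep n h v) (rightTranslate h f) := by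
  funext g
  simp [rightTranslate, mackeyFun_apply]

lemma IsSmooth.mackeyFun {f : G n → ℂ} (hf : IsSmooth f) (v : Fin n → ℂ) :
    IsSmooth (mackeyFun n v f) :=
  hf.fun_smul (IsSmooth.const v).conjStdRep

lemma mackeyFun_mem (lam : Weight n) (v : Fin n → ℂ) {f : G n → ℂ} (hf : f ∈ IndSpace lam.line) :
    mackeyFun n v f ∈ IndSpace lam.lineTensorV := by
  refine ⟨hf.1.mackeyFun v, .of_bilinear (mackeyFun n) (fun k => conjStdRep n (ofK k) v) hf.2.1
    fun k => rightTranslate_mackeyFun _ v f, fun b g => ?_⟩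
  rw [mackeyFun_apply, hf.2.2, line_apply, lineTensorV_apply, mackeyFun_apply]
  simp only [map_mul, Module.End.mul_apply, map_smul, smul_smul, smul_eq_mul]

lemma hasDerivAt_conjStdRep (E : Gl n) (g : G n) (v : Fin n → ℂ) :
    HasDerivAt (fun t : ℝ => conjStdRep n (g * expG (t • E)) v)
      (conjStdRep n g ((conjStd n).gAct E v)) 0 := by
  have h1 : HasDerivAt (fun t : ℝ => conjStdRep n (expG (t • E)) v) ((conjStd n).gAct E v) 0 := by
    rw [hasDerivAt_pi]
    intro i
    have : HasDerivAt
        (fun t : ℝ => ∑ j, conj ((NormedSpace.exp (t • E) : Gl n) i j) * v j)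
        (∑ j, conj (E i j) * v j) 0 :=
      HasDerivAt.fun_sum fun j _ => ((hasDerivAt_exp_entry E i j).star).mul_const _
    exact this
  simp only [map_mul, Module.End.mul_apply]
  exact ((LinearMap.toContinuousLinearMap (conjStdRep n g)).restrictScalars
    ℝ).hasFDerivAt.comp_hasDerivAt (0 : ℝ) h1

/-- The Leibniz rule for the product of `f g` and `\bar g v`; the two terms match the two summands
of the `𝔤`-action on a tensor product. -/
lemma lieDeriv_mackeyFun (E : Gl n) (v : Fin n → ℂ) {f : G n → ℂ} (hf : IsSmooth f) :
    lieDeriv E (mackeyFun n v f) =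
      mackeyFun n v (lieDeriv E f) + mackeyFun n ((conjStd n).gAct E v) f := by
  funext g
  have h := (hf.hasDerivAt' E g).smul (hasDerivAt_conjStdRep E g v)
  rw [expG_zero, mul_one] at h
  refine h.deriv.trans ?_
  rw [Pi.add_apply, mackeyFun_apply, mackeyFun_apply, add_comm]

/-- The Mackey map `X(λ) ⊗ V → Ind (ℂ_λ ⊗ V)`. -/
def mackeyHom (lam : Weight n) :
    IndSpace lam.line ⊗[ℂ] (Fin n → ℂ) →ₗ[ℂ] IndSpace lam.lineTensorV :=
  TensorProduct.lift (LinearMap.mk₂ ℂ (fun f v => ⟨mackeyFun n v f.1, mackeyFun_mem lam v f.2⟩)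
    (fun _ _ v => Subtype.ext ((mackeyFun n v).map_add _ _))
    (fun _ _ v => Subtype.ext ((mackeyFun n v).map_smul _ _))
    (fun _ _ _ => Subtype.ext (LinearMap.map_add₂ _ _ _ _))
    (fun _ _ _ => Subtype.ext (LinearMap.map_smul₂ _ _ _ _)))

lemma mackeyHom_tmul (lam : Weight n) (f : IndSpace lam.line) (v : Fin n → ℂ) :
    (mackeyHom lam (f ⊗ₜ[ℂ] v)).1 = mackeyFun n v f.1 := rfl

/-- The `i`-th coordinate of `g ↦ \bar g⁻¹ F g`. -/
def mackeyCoeff (F : G n → Fin n → ℂ) (i : Fin n) : G n → ℂ := fun g => conjStdRep n g⁻¹ (F g) i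

lemma mackeyCoeff_mem (lam : Weight n) {F : G n → Fin n → ℂ} (hF : F ∈ IndSpace lam.lineTensorV)
    (i : Fin n) : mackeyCoeff F i ∈ IndSpace lam.line := by
  refine ⟨isSmooth_pi.1 hF.1.conjStdRep_inv i, ?_, fun b g => ?_⟩
  · let β : Module.Dual ℂ (Fin n → ℂ) →ₗ[ℂ] (G n → Fin n → ℂ) →ₗ[ℂ] (G n → ℂ) :=
      LinearMap.mk₂ ℂ (fun ξ F g => ξ (conjStdRep n g⁻¹ (F g)))
        (fun _ _ _ => by ext; simp) (fun _ _ _ => by ext; simp)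
        (fun _ _ _ => by ext; simp) (fun _ _ _ => by ext; simp)
    -- The value at `g` of the translate by `k` is the `i`-th coordinate of `\bar k⁻¹ \bar g⁻¹ F (g
    -- k)`: the factor `\bar k⁻¹` is absorbed into the functional, which varies in the finite
    -- dimensional dual of `V`.
    refine .of_bilinear β (fun k => LinearMap.proj i ∘ₗ conjStdRep n (ofK k)⁻¹) hF.2.1 fun k => ?_
    funext g
    simp [β, rightTranslate, mackeyCoeff]
  · rw [mackeyCoeff, hF.2.2, lineTensorV_apply, line_apply, mul_inv_rev, map_mul,
      Module.End.mul_apply, map_smul, map_smul, map_smul, conjStdRep_inv_apply_self, map_smul]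
    rfl

/-- The inverse expands `\bar g⁻¹ F g` in the standard basis, with coefficients in `X(λ)`. -/
lemma mackeyHom_bijective (lam : Weight n) : Function.Bijective (mackeyHom lam) := by
  let inv : IndSpace lam.lineTensorV → IndSpace lam.line ⊗[ℂ] (Fin n → ℂ) := fun F =>
    ∑ i, (⟨mackeyCoeff F.1 i, mackeyCoeff_mem lam F.2 i⟩ : IndSpace lam.line) ⊗ₜ[ℂ]
      (Pi.single i 1 : Fin n → ℂ)
  -- A set-theoretic inverse is enough; additivity is only needed for the induction over tensors.
  have hadd : ∀ F F', inv (F + F') = inv F + inv F' := by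
    intro F F'
    simp only [inv, ← Finset.sum_add_distrib, ← TensorProduct.add_tmul]
    refine Finset.sum_congr rfl fun i _ => ?_
    congr 1
    ext g
    simp [mackeyCoeff]
  refine Function.bijective_iff_has_inverse.2 ⟨inv, fun z => ?_, fun F => ?_⟩
  · induction z with
    | zero =>
      rw [map_zero]
      refine Finset.sum_eq_zero fun i _ => ?_
      convert! TensorProduct.zero_tmul (R := ℂ) (IndSpace lam.line) (Pi.single i 1 : Fin n → ℂ) using 2
      ext g
      simp [mackeyCoeff]
    | add z w hz hw => rw [map_add, hadd, hz, hw]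
    | tmul f v =>
      -- On a pure tensor `\bar g⁻¹` cancels `\bar g`, so the coefficients are the constant
      -- multiples `v i • f`, which reassemble to `f ⊗ v`.
      have h : ∀ i, (⟨mackeyCoeff (mackeyHom lam (f ⊗ₜ[ℂ] v)).1 i,
          mackeyCoeff_mem lam (mackeyHom lam (f ⊗ₜ[ℂ] v)).2 i⟩ : IndSpace lam.line) = v i • f := by
        intro i
        ext g
        change conjStdRep n g⁻¹ (f.1 g • conjStdRep n g v) i = _
        rw [map_smul, conjStdRep_inv_apply_self]
        exact mul_comm _ _
      simp only [inv, h, TensorProduct.smul_tmul, ← TensorProduct.tmul_sum]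
      congr 1
      ext i
      simp [Pi.single_apply]
  · ext1
    funext g
    simp only [inv, map_sum, Submodule.coe_sum, Finset.sum_apply, mackeyHom_tmul, mackeyFun_apply,
      ← map_smul]
    rw [← map_sum]
    convert! conjStdRep_self_apply_inv g (F.1 g) using 2
    ext i
    simp [Pi.single_apply, mackeyCoeff]

/-- The Mackey isomorphism `X(λ) ⊗ V ≅ Ind (ℂ_λ ⊗ V)`. -/
def mackeyIso (lam : Weight n) :
    GKModule.Iso ((principalSeries lam).tensor (conjStd n)) (ind lam.lineTensorV) where
  __ := LinearEquiv.ofBijective (mackeyHom lam) (mackeyHom_bijective lam)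
  map_kAct k z := by
    change mackeyHom lam _ = (ind lam.lineTensorV).kAct k (mackeyHom lam z)
    induction z with
    | zero => simp
    | add z w hz hw => simp only [map_add, hz, hw]
    | tmul f v => exact Subtype.ext (rightTranslate_mackeyFun (ofK k) v f.1).symm
  map_gAct E z := by
    change mackeyHom lam _ = (ind lam.lineTensorV).gAct E (mackeyHom lam z)
    induction z with
    | zero => simp
    | add z w hz hw => simp only [map_add, hz, hw]
    | tmul f v => exact Subtype.ext (lieDeriv_mackeyFun E v f.2.1).symm

end Mackey

/-! ### Gram–Schmidt vectors adapted to the flag -/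

section GramSchmidt

variable {n : ℕ}

/-- The Gram matrix of the inner product `⟨g⁻¹ v, g⁻¹ w⟩`. -/
def gram (g : G n) : Gl n := ((g⁻¹ : G n) : Gl n)ᴴ * ((g⁻¹ : G n) : Gl n)

/-- The matrix whose rows before the `k`-th are those of `gram g`, the others being those of the
identity matrix. -/
def truncGram (k : Fin n) (g : G n) : Gl n :=
  Matrix.diagonal (fun i => if i < k then 1 else 0) * gram g +
    Matrix.diagonal fun i => if i < k then 0 else 1

lemma truncGram_mulVec (k : Fin n) (g : G n) (w : Fin n → ℂ) (i : Fin n) :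
    (truncGram k g).mulVec w i = if i < k then (gram g).mulVec w i else w i := by
  rw [truncGram, Matrix.add_mulVec, ← Matrix.mulVec_mulVec, Pi.add_apply, Matrix.mulVec_diagonal,
    Matrix.mulVec_diagonal]
  split_ifs <;> simp

-- Positive definiteness: in `w* (gram g) w = ‖g⁻¹ w‖²` every summand vanishes, those with `i < k`
-- because `(gram g) w` does at `i`, the others because `w` does.
open scoped ComplexOrder in
lemma eq_zero_of_truncGram_mulVec_eq_zero {k : Fin n} {g : G n} {w : Fin n → ℂ}
    (h : (truncGram k g).mulVec w = 0) : w = 0 := by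
  have h0 : star w ⬝ᵥ (gram g).mulVec w = 0 := by
    refine Finset.sum_eq_zero fun i _ => ?_
    have hi := congrFun h i
    rw [truncGram_mulVec, Pi.zero_apply] at hi
    split_ifs at hi with hik
    · rw [hi, mul_zero]
    · rw [Pi.star_apply, hi, star_zero, zero_mul]
  rw [gram, ← Matrix.mulVec_mulVec, Matrix.dotProduct_mulVec, ← Matrix.star_mulVec,
    dotProduct_star_self_eq_zero] at h0
  have := congrArg ((g : Gl n).mulVec ·) h0
  simpa only [Matrix.mulVec_mulVec, ← Units.val_mul, mul_inv_cancel, Units.val_one,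
    Matrix.one_mulVec, Matrix.mulVec_zero] using this

lemma det_truncGram_ne_zero (k : Fin n) (g : G n) : (truncGram k g).det ≠ 0 := by
  intro h
  obtain ⟨v, hv, hv0⟩ := Matrix.exists_mulVec_eq_zero_iff.2 h
  exact hv (eq_zero_of_truncGram_mulVec_eq_zero hv0)

/-- The vector `w ∈ e_k + span {e_1, …, e_{k-1}}` such that `g⁻¹ w` is orthogonal to
`g⁻¹ e_1, …, g⁻¹ e_{k-1}`. -/
def orthVec (k : Fin n) (g : G n) : Fin n → ℂ := (truncGram k g)⁻¹.mulVec (Pi.single k 1)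

lemma truncGram_mulVec_orthVec (k : Fin n) (g : G n) :
    (truncGram k g).mulVec (orthVec k g) = Pi.single k 1 := by
  rw [orthVec, Matrix.mulVec_mulVec, Matrix.mul_nonsing_inv _ (det_truncGram_ne_zero k g).isUnit,
    Matrix.one_mulVec]

/-- Uniqueness of the Gram–Schmidt vector. It lets covariance be proved by checking the defining
conditions instead of computing inverse matrices. -/
lemma eq_orthVec {k : Fin n} {g : G n} {w : Fin n → ℂ}
    (h1 : ∀ i, i < k → (gram g).mulVec w i = 0)
    (h2 : ∀ i, k ≤ i → w i = (Pi.single k 1 : Fin n → ℂ) i) : w = orthVec k g := by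
  rw [← sub_eq_zero]
  refine eq_zero_of_truncGram_mulVec_eq_zero (k := k) (g := g) ?_
  rw [Matrix.mulVec_sub, truncGram_mulVec_orthVec, sub_eq_zero]
  funext i
  rw [truncGram_mulVec]
  split_ifs with h
  · rw [h1 i h, Pi.single_eq_of_ne h.ne]
  · exact h2 i (not_lt.1 h)

lemma gram_mulVec_orthVec {k : Fin n} (g : G n) {i : Fin n} (hi : i < k) :
    (gram g).mulVec (orthVec k g) i = 0 := by
  have := congrFun (truncGram_mulVec_orthVec k g) i
  rwa [truncGram_mulVec, if_pos hi, Pi.single_eq_of_ne hi.ne] at this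

lemma orthVec_apply {k : Fin n} (g : G n) {i : Fin n} (hi : k ≤ i) :
    orthVec k g i = (Pi.single k 1 : Fin n → ℂ) i := by
  have := congrFun (truncGram_mulVec_orthVec k g) i
  rwa [truncGram_mulVec, if_neg hi.not_gt] at this

lemma isSmooth_orthVec (k : Fin n) : IsSmooth (orthVec (n := n) k) :=
  IsSmoothMat.mulVec (((IsSmoothMat.const _).mul
    (IsSmoothMat.coe_inv.conjTranspose.mul IsSmoothMat.coe_inv)).add (IsSmoothMat.const _)
    |>.inv (det_truncGram_ne_zero k)) (IsSmooth.const _)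

/-- Passing from `g` to `g u` replaces `g⁻¹` by `u⁻¹ g⁻¹`, and `u⁻¹` is an isometry. -/
lemma gram_mul_ofK (g : G n) (k : UnitaryK n) : gram (g * ofK k) = gram g := by
  have h : ((((ofK k)⁻¹ : G n) : Gl n))ᴴ * (((ofK k)⁻¹ : G n) : Gl n) = 1 := by
    rw [coe_ofK_inv, ← Matrix.star_eq_conjTranspose, star_star]
    exact Unitary.coe_mul_star_self k
  rw [gram, mul_inv_rev, Units.val_mul, Matrix.conjTranspose_mul, mul_assoc,
    ← mul_assoc _ _ (((g⁻¹ : G n) : Gl n)), h, one_mul, gram]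

lemma orthVec_mul_ofK (k : Fin n) (g : G n) (u : UnitaryK n) :
    orthVec k (g * ofK u) = orthVec k g := by
  rw [orthVec, orthVec, truncGram, truncGram, gram_mul_ofK]

lemma gram_mul (b g : G n) : gram (b * g) * (b : Gl n) = ((b⁻¹ : G n) : Gl n)ᴴ * gram g := by
  have : ((b⁻¹ : G n) : Gl n) * (b : Gl n) = 1 := by rw [← Units.val_mul, inv_mul_cancel]; rfl
  rw [gram, gram, mul_inv_rev, Units.val_mul, Matrix.conjTranspose_mul, mul_assoc, mul_assoc,
    mul_assoc, this, mul_one]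

lemma borel_mulVec_apply {b : G n} (hb : b ∈ borel n) {k : Fin n} {w : Fin n → ℂ}
    (hw : ∀ i, k < i → w i = 0) {i : Fin n} (hi : k ≤ i) :
    (b : Gl n).mulVec w i = b i i * w i := by
  refine Finset.sum_eq_single i (fun j _ hj => ?_) fun h => absurd (Finset.mem_univ _) h
  change (b : Gl n) i j * w j = 0
  rcases lt_or_gt_of_ne hj with h | h
  · rw [hb h, zero_mul]
  · rw [hw j (hi.trans_lt h), mul_zero]

/-- Since `(b g)⁻¹ b = g⁻¹` and `b` preserves the flag, `b w(g)` satisfies the orthogonality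
conditions for `b g`. Its `k`-th coordinate is `b_k`, so `b_k⁻¹ b w(g)` is the normalized vector. -/
lemma orthVec_borel_mul (k : Fin n) {b : G n} (hb : b ∈ borel n) (g : G n) :
    b k k • orthVec k (b * g) = (b : Gl n).mulVec (orthVec k g) := by
  have hk := borel_diag_ne_zero hb k
  rw [← eq_orthVec (w := (b k k)⁻¹ • (b : Gl n).mulVec (orthVec k g)), smul_inv_smul₀ hk]
  · intro i hi
    rw [Matrix.mulVec_smul, Matrix.mulVec_mulVec, gram_mul, ← Matrix.mulVec_mulVec, Pi.smul_apply]
    refine smul_eq_zero_of_right _ ?_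
    rw [Matrix.mulVec, dotProduct]
    refine Finset.sum_eq_zero fun j _ => ?_
    -- For `j > i` the entry of `b⁻¹` vanishes by triangularity; for `j ≤ i < k` orthogonality of
    -- `w(g)` applies.
    rcases lt_or_ge i j with h | h
    · have : ((b⁻¹ : G n) : Gl n) j i = 0 := (borel n).inv_mem hb h
      rw [Matrix.conjTranspose_apply, this, star_zero, zero_mul]
    · rw [gram_mulVec_orthVec g (h.trans_lt hi), mul_zero]
  · intro i hi
    rw [Pi.smul_apply, borel_mulVec_apply hb (fun j hj => by
      rw [orthVec_apply g hj.le, Pi.single_eq_of_ne hj.ne']) hi, orthVec_apply g hi]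
    rcases eq_or_ne i k with rfl | h
    · simp [hk]
    · simp [Pi.single_eq_of_ne h]

end GramSchmidt

/-! ### Stable subspaces and subquotients of `(𝔤, K)`-modules -/

section Subquotient

variable {n : ℕ} {X Y : Type*} [AddCommGroup X] [Module ℂ X] [AddCommGroup Y] [Module ℂ Y]
  {A : GKModule n X} {B : GKModule n Y}

lemma GKModule.IsStable.comap (M : GKModule.Iso A B) {P : Submodule ℂ Y} (hP : B.IsStable P) :
    A.IsStable (P.comap M.toLinearEquiv.toLinearMap) :=
  ⟨fun k x hx => by
    rw [Submodule.mem_comap, LinearEquiv.coe_coe, M.map_kAct]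
    exact hP.1 k _ hx, fun E x hx => by
    rw [Submodule.mem_comap, LinearEquiv.coe_coe, M.map_gAct]
    exact hP.2 E _ hx⟩

/-- A surjective homomorphism `Q → Y` of `(𝔤, K)`-modules with kernel `P` induces `Q / P ≅ Y`. -/
def GKModule.subquotIsoOfSurjective {P Q : Submodule ℂ X} (hP : A.IsStable P) (hQ : A.IsStable Q)
    (T : Q →ₗ[ℂ] Y) (hT : Function.Surjective T) (hker : LinearMap.ker T = P.submoduleOf Q)
    (hk : ∀ k x, T ((A.sub hQ).kAct k x) = B.kAct k (T x))
    (hg : ∀ E x, T ((A.sub hQ).gAct E x) = B.gAct E (T x)) :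
    GKModule.Iso (A.subquot hP hQ) B where
  __ := (Submodule.quotEquivOfEq _ _ hker.symm).trans (T.quotKerEquivOfSurjective hT)
  map_kAct k x := by
    obtain ⟨x, rfl⟩ := Submodule.mkQ_surjective _ x
    exact hk k x
  map_gAct E x := by
    obtain ⟨x, rfl⟩ := Submodule.mkQ_surjective _ x
    exact hg E x

end Subquotient

/-! ### The filtration and its graded pieces -/

section Filtration

variable {n : ℕ} (lam : Weight n)

/-- Both sides use the same branch of the logarithm, so no integrality is needed. -/
lemma cpowConj_add_one (a b : ℂ) {z : ℂ} (hz : z ≠ 0) :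
    cpowConj a (b + 1) z = cpowConj a b z * conj z := by
  conv_rhs => rw [← Complex.exp_log hz]
  rw [cpowConj, cpowConj, ← Complex.exp_conj, Complex.exp_log hz, ← Complex.exp_add]
  ring_nf

lemma character_addR (k : Fin n) (b : borel n) :
    (lam.addR k).character b = lam.character b * conj ((b : G n) k k) := by
  change ∏ i, cpowConj (lam.L i) ((lam.R + Pi.single k 1 : Fin n → ℂ) i) ((b : G n) i i) =
    (∏ i, cpowConj (lam.L i) (lam.R i) ((b : G n) i i)) * _
  rw [← Finset.prod_erase_mul _ _ (Finset.mem_univ k),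
    ← Finset.prod_erase_mul (f := fun i => cpowConj (lam.L i) (lam.R i) ((b : G n) i i)) _
      (Finset.mem_univ k), mul_assoc, ← cpowConj_add_one _ _ (borel_diag_ne_zero b.2 k)]
  congr 1
  · refine Finset.prod_congr rfl fun i hi => ?_
    simp [Finset.ne_of_mem_erase hi]
  · simp

/-- The subspace of `V_k`-valued functions in `Ind (ℂ_λ ⊗ V)`. -/
def flagInd (k : ℕ) : Submodule ℂ (IndSpace lam.lineTensorV) where
  carrier := {F | ∀ g, F.1 g ∈ flag n k}
  add_mem' ha hb g := (flag n k).add_mem (ha g) (hb g)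
  zero_mem' _ := (flag n k).zero_mem
  smul_mem' c _ hF g := (flag n k).smul_mem c (hF g)

lemma flagInd_isStable (k : ℕ) : (ind lam.lineTensorV).IsStable (flagInd lam k) := by
  refine ⟨fun u F hF g => hF _, fun E F hF g i hi => ?_⟩
  change lieDeriv E F.1 g i = 0
  rw [← lieDeriv_apply E F.2.1, lieDeriv]
  -- The coordinate vanishes identically on `G`, hence so does its derivative.
  simp only [hF _ i hi, deriv_const]

lemma flag_mono {k l : ℕ} (h : k ≤ l) : flag n k ≤ flag n l := fun _ hv i hi => hv i (h.trans hi)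

/-- This is the character of `B` on the line `V_{k+1} / V_k`; indices start at `0`, so `k` is the
last coordinate allowed in `flag n (k + 1)`. -/
lemma conjStdRep_borel_apply {b : G n} (hb : b ∈ borel n) {k : Fin n} {v : Fin n → ℂ}
    (hv : v ∈ flag n (k + 1)) : conjStdRep n b v k = conj (b k k) * v k := by
  refine Finset.sum_eq_single k (fun j _ hj => ?_) fun h => absurd (Finset.mem_univ _) h
  change conj ((b : Gl n) k j) * v j = 0
  rcases lt_or_gt_of_ne hj with h | h
  · rw [hb h, map_zero, zero_mul]
  · rw [hv j h, mul_zero]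

/-- The `k`-th coordinate of `V_k`-valued functions, `Ind (ℂ_λ ⊗ V_k) → X(λ_L, λ_R + e_k)`. -/
def flagCoord (k : Fin n) : flagInd lam (k + 1) →ₗ[ℂ] IndSpace (lam.addR k).line where
  toFun F := ⟨fun g => F.1.1 g k, isSmooth_pi.1 F.1.2.1 k,
    .of_linear { toFun := fun (F : G n → Fin n → ℂ) g => F g k, map_add' := fun _ _ => rfl, map_smul' := fun _ _ => rfl }
      F.1.2.2.1 fun _ => rfl, fun b g => by
      change F.1.1 (b * g) k = _ • (lam.addR k).line b (F.1.1 g k)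
      rw [F.1.2.2.2, lineTensorV_apply, line_apply, character_addR, Pi.smul_apply, Pi.smul_apply,
        conjStdRep_borel_apply b.2 (F.2 g), smul_eq_mul, smul_eq_mul, smul_eq_mul, mul_assoc]⟩
  map_add' _ _ := rfl
  map_smul' _ _ := rfl

lemma flagCoord_apply (k : Fin n) (F : flagInd lam (k + 1)) (g : G n) :
    (flagCoord lam k F).1 g = F.1.1 g k := rfl

/-- The preimage of `φ` is `φ` times the conjugate of the Gram–Schmidt vector. Right `K`-invariance
of that vector makes multiplication by it commute with `K`-translations, which preserves
`K`-finiteness. -/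
lemma flagCoord_surjective (k : Fin n) : Function.Surjective (flagCoord lam k) := by
  intro φ
  have hflag : ∀ g, ∀ i : Fin n, (k : ℕ) + 1 ≤ i → orthVec k g i = 0 := fun g i hi => by
    rw [orthVec_apply g (Fin.le_def.2 (by omega)), Pi.single_eq_of_ne (Fin.ne_of_gt hi)]
  refine ⟨⟨⟨fun g => φ.1 g • star (orthVec k g), ?_, ?_, fun b g => ?_⟩, fun g i hi => ?_⟩, ?_⟩
  · exact φ.2.1.fun_smul (isSmooth_pi.2 fun i => (isSmooth_pi.1 (isSmooth_orthVec k) i).fun_conj)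
  · refine .of_linear { toFun := fun f g => f g • star (orthVec k g), map_add' := ?_, map_smul' := ?_ }
      φ.2.2.1 fun u => ?_
    · intro f f'
      ext
      simp [add_mul]
    · intro c f
      ext
      simp [mul_assoc]
    · funext g
      simp [rightTranslate, orthVec_mul_ofK]
  -- Covariance of the Gram–Schmidt vector, conjugated because `b` acts on `V` through `\bar b`. The
  -- factor `\bar b_k` is the extra factor in the character of `(λ_L, λ_R + e_k)`.
  · have h : star ((b : G n) k k) • star (orthVec k ((b : G n) * g)) =
        conjStdRep n b (star (orthVec k g)) := by
      rw [← star_smul, orthVec_borel_mul k b.2, Matrix.star_mulVec, ← Matrix.mulVec_transpose]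
      rfl
    change φ.1 (b * g) • star (orthVec k (b * g)) = _ • lam.lineTensorV b (φ.1 g • _)
    rw [φ.2.2.2, line_apply, character_addR, lineTensorV_apply, map_smul, ← h]
    simp only [smul_smul, smul_eq_mul]
    congr 1
    change _ = _ * (_ * (_ * conj _))
    ring
  · change φ.1 g * star (orthVec k g i) = 0
    rw [hflag g i hi, star_zero, mul_zero]
  · ext g
    change φ.1 g * star (orthVec k g k) = φ.1 g
    rw [orthVec_apply g le_rfl, Pi.single_eq_same, star_one, mul_one]

/-- The filtration `X_k = M⁻¹ (Ind (ℂ_λ ⊗ V_k))` of `X(λ) ⊗ V`. -/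
def mackeyFiltration (k : ℕ) : Submodule ℂ (IndSpace lam.line ⊗[ℂ] (Fin n → ℂ)) :=
  (flagInd lam k).comap (mackeyIso lam).toLinearEquiv.toLinearMap

lemma mackeyFiltration_isStable (k : ℕ) :
    ((principalSeries lam).tensor (conjStd n)).IsStable (mackeyFiltration lam k) :=
  GKModule.IsStable.comap (mackeyIso lam) (flagInd_isStable lam k)

/-- The map `X_k → X(λ_L, λ_R + e_k)` whose kernel is `X_{k-1}`. -/
def filtrationCoord (k : Fin n) :
    mackeyFiltration lam (k + 1) →ₗ[ℂ] IndSpace (lam.addR k).line :=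
  flagCoord lam k ∘ₗ (mackeyIso lam).toLinearEquiv.toLinearMap.restrict fun _ hx => hx

lemma filtrationCoord_apply (k : Fin n) (x : mackeyFiltration lam (k + 1)) (g : G n) :
    (filtrationCoord lam k x).1 g = ((mackeyIso lam).toLinearEquiv x.1).1 g k := rfl

lemma filtrationCoord_surjective (k : Fin n) : Function.Surjective (filtrationCoord lam k) := by
  intro φ
  obtain ⟨F, hF⟩ := flagCoord_surjective lam k φ
  refine ⟨⟨(mackeyIso lam).toLinearEquiv.symm F.1, fun g => ?_⟩, ?_⟩
  · rw [LinearEquiv.coe_coe, LinearEquiv.apply_symm_apply]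
    exact F.2 g
  · ext g
    rw [filtrationCoord_apply, LinearEquiv.apply_symm_apply, ← hF, flagCoord_apply]

lemma ker_filtrationCoord (k : Fin n) : LinearMap.ker (filtrationCoord lam k) =
    (mackeyFiltration lam k).submoduleOf (mackeyFiltration lam (k + 1)) := by
  ext x
  rw [LinearMap.mem_ker]
  constructor
  -- Membership in `V_k` differs from membership in `V_{k+1}` only by the vanishing of coordinate
  -- `k`.
  · intro h g i hi
    rcases hi.eq_or_lt with hi | hi
    · obtain rfl := Fin.ext hi
      rw [← Pi.zero_apply (M := fun _ : G n => ℂ) g]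
      exact congrFun (congrArg Subtype.val h) g
    · exact x.2 g i hi
  · intro h
    ext g
    exact h g k le_rfl

/-- The isomorphism `X_k / X_{k-1} ≅ X(λ_L, λ_R + e_k)`. -/
def subquotIso (k : Fin n) :
    GKModule.Iso (((principalSeries lam).tensor (conjStd n)).subquot
      (mackeyFiltration_isStable lam k) (mackeyFiltration_isStable lam (k + 1)))
      (principalSeries (lam.addR k)) :=
  GKModule.subquotIsoOfSurjective _ _ (filtrationCoord lam k) (filtrationCoord_surjective lam k)
    (ker_filtrationCoord lam k)
    (fun u x => by
      ext g
      exact congrFun (congrFun (congrArg Subtype.val ((mackeyIso lam).map_kAct u x.1)) g) k)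
    (fun E x => by
      ext g
      refine (congrFun (congrFun (congrArg Subtype.val
        ((mackeyIso lam).map_gAct E x.1)) g) k).trans ?_
      exact (lieDeriv_apply E ((mackeyIso lam).toLinearEquiv x.1).2.1 k g).symm)

end Filtration

end GLComplex

end

theorem mainTheorem6 (n : ℕ) (lam : Weight n) :
    ∃ (M : GKModule.Iso ((principalSeries lam).tensor (conjStd n)) (ind lam.lineTensorV))
      (X : Fin (n + 1) → Submodule ℂ (IndSpace lam.line ⊗[ℂ] (Fin n → ℂ)))
      (hX : ∀ k, ((principalSeries lam).tensor (conjStd n)).IsStable (X k)),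
      (∀ (f : IndSpace lam.line) (v : Fin n → ℂ) (g : G n),
        (M.toLinearEquiv (f ⊗ₜ[ℂ] v)).1 g = f.1 g • conjStdRep n g v) ∧
      (∀ (k : Fin (n + 1)) (x : IndSpace lam.line ⊗[ℂ] (Fin n → ℂ)),
        x ∈ X k ↔ ∀ g : G n, (M.toLinearEquiv x).1 g ∈ flag n k) ∧
      X 0 = ⊥ ∧
      X (Fin.last n) = ⊤ ∧
      (∀ k : Fin n, X k.castSucc ≤ X k.succ) ∧
      ∀ k : Fin n, Nonempty (GKModule.Iso
        (((principalSeries lam).tensor (conjStd n)).subquot (hX k.castSucc) (hX k.succ))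
        (principalSeries (lam.addR k))) := by
  refine ⟨mackeyIso lam, fun k => mackeyFiltration lam k,
    fun k => mackeyFiltration_isStable lam k, fun _ _ _ => rfl, fun _ _ => Iff.rfl, ?_, ?_,
    fun k x hx g => flag_mono k.val.le_succ (hx g), fun k => ⟨subquotIso lam k⟩⟩
  · refine (Submodule.eq_bot_iff _).2 fun x hx =>
      (LinearEquiv.map_eq_zero_iff (mackeyIso lam).toLinearEquiv).1 ?_
    ext g i
    exact hx g i (Nat.zero_le _)
  -- `V_n` is all of `V`: no index `i : Fin n` satisfies `n ≤ i`.
  · exact eq_top_iff.2 fun x _ g i hi => absurd i.2 hi.not_gt
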